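/- **Definitions.** Let $\mathcal A$ be a unital $*$-algebra over $\mathbb C$ and $\phi,\psi$ states (positive unital linear functionals) on it. Let $NC(n)$ be the set of non-crossing partitions of $\{1,\dots,n\}$. A block $V$ of $\pi\in NC(n)$ is *inner* if there are $y_1,y_2$ in one block of $\pi$ with $y_1<x<y_2$ for all $x\in V$, and *outer* otherwise. The free cumulants $R^\psi$ and the two-state free cumulants $R^{\phi,\psi}$ are defined recursively by $$\psi[a_1\cdots a_n]=\sum_{\pi\in NC(n)}\prod_{V\in\pi}R^\psi(a_1,\dots,a_n:V),$$ $$\phi[a_1\cdots a_n]=\sum_{\pi\in NC(n)}\ \prod_{V\text{ outer}}R^{\phi,\psi}(a_1,\dots,a_n:V)\prod_{V\text{ inner}}R^{\psi}(a_1,\dots,a_n:V)\qquad(n\ge 1),$$ where $f(a_1,\dots,a_n:V)=f(a_{i(1)},\dots,a_{i(k)})$ for $V=\{i(1)<\dots<i(k)\}$. Write $R^\psi_n(x)=R^\psi(x,\dots,x)$ and $R^{\phi,\psi}_n(x)=R^{\phi,\psi}(x,\dots,x)$ ($n$ arguments). Unital subalgebras $(\mathcal A_i)_i$ are *two-state freely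 independent* if for all $n\ge1$ and $a_j\in\mathcal A_{i(j)}$ ($1\le j\le n$) with $i(j)\ne i(j+1)$ and all $\psi[a_j]=0$, one has $\psi[a_1\cdots a_n]=0$ and $\phi[a_1\cdots a_n]=\phi[a_1]\cdots\phi[a_n]$. Elements are two-state freely independent if the unital subalgebras they generate are. Let $T>0$. A family $\{X(t)\}_{0\le t\le T}$ of self-adjoint elements of $\mathcal A$ is an *algebraic two-state free Brownian motion* if $X(0)=0$; $\phi[X(t)]=0$ for all $t$; the increments $X(t_i)-X(s_i)$ over finitely many pairwise disjoint intervals $[s_i,t_i)\subset[0,T]$ are two-state freely independent; the distributions of the increments with respect to $\phi$ and to $\psi$ are stationary (i.e. $X(t+h)-X(s+h)$ and $X(t)-X(s)$ have the same moments); and for $0\le s\le t\le T$ $$R^{\phi,\psi}_n(X(t)-X(s))=0\ \text{ for all } n>2,\qquad \phi[(X(t)-X(s))^2]=t-s.$$ For $\alpha\in\mathbb R$, it is a *two-state free Brownian motion with parameter $\alpha$* if moreover, for all $t\in[0,T]$, $R^\psi_1(X(t))=\alpha t$, $R^\psi_2(X(t))=R^{\phi,\psi}_2(X(t))=t$, and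 $R^\psi_k(X(t))=0$ for all $k>2$. **Statement.** Let $\mathcal A$ be a unital $C^*$-algebra, $\phi,\psi$ states on $\mathcal A$ with $\phi$ faithful (i.e. $\phi[a^*a]=0$ implies $a=0$), and $T>0$. Suppose that $\mathcal A$ is generated, as a $C^*$-algebra, by an algebraic two-state free Brownian motion $\{X(t)\}_{0\le t\le T}$ all of whose $\psi$-free cumulants are non-negative: $R^\psi_n(X(t))\ge0$ for all $n\ge1$ and $t\in[0,T]$. Suppose also that, in the operator norm, $$\lim_{N\to\infty}\sum_{i=1}^N\Bigl(X\bigl(\tfrac iNT\bigr)-X\bigl(\tfrac{i-1}NT\bigr)\Bigr)^k=0\quad\text{for every integer }k>2,\qquad \lim_{N\to\infty}\sum_{i=1}^N\Bigl(X\bigl(\tfrac iNT\bigr)-X\bigl(\tfrac{i-1}NT\bigr)\Bigr)^2=T\cdot 1 .$$ Then there is $\alpha\in\mathbb R$ such that $\{X(t)\}_{0\le t\le T}$ is a two-state free Brownian motion with parameter $\alpha$. -/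

import Mathlib

open Filter Topology
open scoped ComplexOrder

noncomputable section

namespace TwoStateFree

/-! ### Non-crossing partitions of `Fin n` -/

/-- A partition of `{0, …, n-1}` is non-crossing if `x₁ < y₁ < x₂ < y₂` with `x₁, x₂` in a block `U`
and `y₁, y₂` in a block `V` forces `U = V`. -/
def IsNonCrossing {n : ℕ} (P : Finpartition (Finset.univ : Finset (Fin n))) : Prop :=
  ∀ U ∈ P.parts, ∀ V ∈ P.parts, ∀ x₁ ∈ U, ∀ y₁ ∈ V, ∀ x₂ ∈ U, ∀ y₂ ∈ V,
    x₁ < y₁ → y₁ < x₂ → x₂ < y₂ → U = V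

/-- The block `V` is inner: it lies strictly between two points `y₁ < y₂` of one single block
(which is then necessarily another block). Blocks that are not inner are outer. -/
def IsInner {n : ℕ} (P : Finpartition (Finset.univ : Finset (Fin n))) (V : Finset (Fin n)) : Prop :=
  ∃ U ∈ P.parts, ∃ y₁ ∈ U, ∃ y₂ ∈ U, ∀ x ∈ V, y₁ < x ∧ x < y₂

open Classical in
/-- The finite set `NC(n)` of non-crossing partitions. -/
def NC (n : ℕ) : Finset (Finpartition (Finset.univ : Finset (Fin n))) :=
  Finset.univ.filter IsNonCrossing

open Classical in
/-- The non-crossing partitions different from the one-block partition, i.e. those all of whose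
blocks have fewer than `n` elements. -/
def properNC (n : ℕ) : Finset (Finpartition (Finset.univ : Finset (Fin n))) :=
  (NC n).filter fun P => ∀ V ∈ P.parts, V.card < n

/-- The tuple `(a_{i(1)}, …, a_{i(k)})` where `V = {i(1) < … < i(k)}`. -/
def restrict {A : Type*} {n : ℕ} (a : Fin n → A) (V : Finset (Fin n)) : Fin V.card → A :=
  fun j => a (V.orderEmbOfFin rfl j)

lemma restrict_univ_congr {A : Type*} {n : ℕ} (F : (m : ℕ) → (Fin m → A) → ℂ) (a : Fin n → A) :
    F (Finset.univ : Finset (Fin n)).card (restrict a Finset.univ) = F n a := by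
  have key : ∀ (m : ℕ) (h : (Finset.univ : Finset (Fin n)).card = m),
      F (Finset.univ : Finset (Fin n)).card (restrict a Finset.univ)
        = F m fun j => a ((Finset.univ : Finset (Fin n)).orderEmbOfFin h j) := by
    rintro m rfl; rfl
  rw [key n (by simp)]
  congr 1
  ext j
  congr 1
  have := Finset.orderEmbOfFin_unique' (s := (Finset.univ : Finset (Fin n))) (by simp)
    (f := (OrderIso.refl (Fin n)).toOrderEmbedding) (by simp)
  rw [← this]
  rfl

/-! ### Free and two-state free cumulants -/

section Cumulants

variable {A : Type*} [Ring A] [Algebra ℂ A]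

/-- The moment `ψ[a₁ a₂ ⋯ aₙ]`. -/
def moment (ψ : A →ₗ[ℂ] ℂ) {n : ℕ} (a : Fin n → A) : ℂ := ψ (List.ofFn a).prod

/-- The free cumulant functional `R^ψ(a₁, …, aₙ)`: the moment-cumulant formula
`ψ[a₁ ⋯ aₙ] = ∑_{π ∈ NC(n)} ∏_{V ∈ π} R^ψ(a : V)`, solved for the term of the one-block partition.
See `moment_eq_sum_freeCumulant`. (The `else` branch is never reached.) -/
def freeCumulant (ψ : A →ₗ[ℂ] ℂ) (n : ℕ) (a : Fin n → A) : ℂ :=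
  moment ψ a - ∑ P ∈ properNC n, ∏ V ∈ P.parts,
    if _h : V.card < n then freeCumulant ψ V.card (restrict a V) else 0
termination_by n

open Classical in
/-- The two-state free cumulant functional `R^{φ,ψ}(a₁, …, aₙ)`: the formula
`φ[a₁ ⋯ aₙ] = ∑_{π ∈ NC(n)} ∏_{V outer} R^{φ,ψ}(a : V) ∏_{V inner} R^ψ(a : V)`, solved for the
term of the one-block partition. See `moment_eq_sum_twoStateCumulant`. -/
def twoStateCumulant (φ ψ : A →ₗ[ℂ] ℂ) (n : ℕ) (a : Fin n → A) : ℂ :=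
  moment φ a - ∑ P ∈ properNC n, ∏ V ∈ P.parts,
    if IsInner P V then freeCumulant ψ V.card (restrict a V)
    else if _h : V.card < n then twoStateCumulant φ ψ V.card (restrict a V) else 0
termination_by n

/-- `R^ψ_n(x) = R^ψ(x, …, x)`. -/
def freeCumulantOf (ψ : A →ₗ[ℂ] ℂ) (n : ℕ) (x : A) : ℂ := freeCumulant ψ n fun _ => x

/-- `R^{φ,ψ}_n(x) = R^{φ,ψ}(x, …, x)`. -/
def twoStateCumulantOf (φ ψ : A →ₗ[ℂ] ℂ) (n : ℕ) (x : A) : ℂ := twoStateCumulant φ ψ n fun _ => x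

lemma univ_mem_parts_of_not_proper {n : ℕ}
    (P : Finpartition (Finset.univ : Finset (Fin n))) :
    (¬ ∀ V ∈ P.parts, V.card < n) ↔ P.parts = {Finset.univ} := by
  constructor
  · intro h
    push Not at h
    obtain ⟨V, hV, hc⟩ := h
    have hVu : V = Finset.univ := by
      rw [← Finset.card_eq_iff_eq_univ, Fintype.card_fin]
      exact le_antisymm (by simpa using Finset.card_le_univ V) hc
    subst hVu
    ext W
    simp only [Finset.mem_singleton]
    constructor
    · intro hW
      obtain ⟨x, hx⟩ := P.nonempty_of_mem_parts hW
      exact P.eq_of_mem_parts hW hV hx (Finset.mem_univ x)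
    · rintro rfl; exact hV
  · intro h h'
    have := h' Finset.univ (by simp [h])
    simp at this

/-- The one-block partition. -/
def oneBlock (n : ℕ) (hn : n ≠ 0) : Finpartition (Finset.univ : Finset (Fin n)) :=
  Finpartition.indiscrete (by
    have : NeZero n := ⟨hn⟩
    exact Finset.univ_nonempty.ne_empty)

lemma NC_eq (n : ℕ) (hn : n ≠ 0) :
    oneBlock n hn ∉ properNC n ∧ ∀ P, P ∈ NC n ↔ P = oneBlock n hn ∨ P ∈ properNC n := by
  have h1 : (oneBlock n hn).parts = {Finset.univ} := rfl
  refine ⟨?_, fun P => ?_⟩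
  · intro h
    exact (univ_mem_parts_of_not_proper _).2 h1 (Finset.mem_filter.1 h).2
  · by_cases hP : ∀ V ∈ P.parts, V.card < n
    · have : P ≠ oneBlock n hn := by
        rintro rfl
        exact (univ_mem_parts_of_not_proper _).2 h1 hP
      simp only [this, false_or, properNC, Finset.mem_filter]
      tauto
    · have h2 := (univ_mem_parts_of_not_proper P).1 hP
      have : P = oneBlock n hn := Finpartition.ext (h2.trans h1.symm)
      simp only [this, true_or, iff_true, NC, Finset.mem_filter, Finset.mem_univ, true_and]
      intro U hU V hV _ _ _ _ _ _ _ _ _ _ _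
      rw [h1, Finset.mem_singleton] at hU hV
      rw [hU, hV]

lemma sum_NC {n : ℕ} (hn : n ≠ 0)
    (f : Finpartition (Finset.univ : Finset (Fin n)) → ℂ) :
    ∑ P ∈ NC n, f P = f (oneBlock n hn) + ∑ P ∈ properNC n, f P := by
  classical
  obtain ⟨h1, h2⟩ := NC_eq n hn
  rw [← Finset.sum_insert h1]
  congr 1
  ext P
  simp [h2 P]

/-- The moment-cumulant formula for `R^ψ`. -/
theorem moment_eq_sum_freeCumulant (ψ : A →ₗ[ℂ] ℂ) {n : ℕ} (hn : n ≠ 0) (a : Fin n → A) :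
    moment ψ a = ∑ P ∈ NC n, ∏ V ∈ P.parts, freeCumulant ψ V.card (restrict a V) := by
  rw [sum_NC hn]
  have h1 : (oneBlock n hn).parts = {Finset.univ} := rfl
  rw [h1, Finset.prod_singleton, restrict_univ_congr (freeCumulant ψ) a, freeCumulant]
  rw [sub_add_eq_add_sub, eq_sub_iff_add_eq]
  congr 1
  refine Finset.sum_congr rfl fun P hP => Finset.prod_congr rfl fun V hV => ?_
  rw [dif_pos ((Finset.mem_filter.1 hP).2 V hV)]

open Classical in
/-- The moment-cumulant formula for `R^{φ,ψ}`. -/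
theorem moment_eq_sum_twoStateCumulant (φ ψ : A →ₗ[ℂ] ℂ) {n : ℕ} (hn : n ≠ 0) (a : Fin n → A) :
    moment φ a = ∑ P ∈ NC n,
      (∏ V ∈ P.parts with ¬ IsInner P V, twoStateCumulant φ ψ V.card (restrict a V)) *
        ∏ V ∈ P.parts with IsInner P V, freeCumulant ψ V.card (restrict a V) := by
  have hprod : ∀ P : Finpartition (Finset.univ : Finset (Fin n)),
      (∏ V ∈ P.parts with ¬ IsInner P V, twoStateCumulant φ ψ V.card (restrict a V)) *
        (∏ V ∈ P.parts with IsInner P V, freeCumulant ψ V.card (restrict a V)) =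
      ∏ V ∈ P.parts, if IsInner P V then freeCumulant ψ V.card (restrict a V)
        else twoStateCumulant φ ψ V.card (restrict a V) := by
    intro P
    rw [Finset.prod_ite, mul_comm]
  simp only [hprod]
  rw [sum_NC hn]
  have h1 : (oneBlock n hn).parts = {Finset.univ} := rfl
  have h2 : ¬ IsInner (oneBlock n hn) Finset.univ := by
    rintro ⟨U, -, y₁, -, y₂, -, h⟩
    exact lt_irrefl _ (h y₁ (Finset.mem_univ _)).1
  rw [h1, Finset.prod_singleton, if_neg h2, restrict_univ_congr (twoStateCumulant φ ψ) a,
    twoStateCumulant, sub_add_eq_add_sub, eq_sub_iff_add_eq]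
  congr 1
  refine Finset.sum_congr rfl fun P hP => Finset.prod_congr rfl fun V hV => ?_
  rw [dif_pos ((Finset.mem_filter.1 hP).2 V hV)]

end Cumulants

/-! ### States and two-state free independence -/

section Processes

variable {A : Type*} [Ring A] [StarRing A] [Algebra ℂ A]

/-- A state: a positive unital linear functional. -/
structure IsState (φ : A →ₗ[ℂ] ℂ) : Prop where
  nonneg : ∀ a : A, 0 ≤ φ (star a * a)
  map_one : φ 1 = 1

/-- A functional is faithful if `φ[a* a] = 0` only for `a = 0`. -/
def IsFaithful (φ : A →ₗ[ℂ] ℂ) : Prop :=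
  ∀ a : A, φ (star a * a) = 0 → a = 0

/-- The (unital) subalgebras `B i` are two-state freely independent: for every alternating word of
length `n + 1 ≥ 1` in `ψ`-centered elements, `ψ` of the product vanishes (that is, the family is
`ψ`-freely independent) and `φ` of the product is the product of the values of `φ`. -/
def IsTwoStateFree (φ ψ : A →ₗ[ℂ] ℂ) {ι : Type*} (B : ι → Subalgebra ℂ A) : Prop :=
  ∀ (n : ℕ) (i : Fin (n + 1) → ι) (a : Fin (n + 1) → A),
    (∀ j, a j ∈ B (i j)) → (∀ j : Fin n, i j.castSucc ≠ i j.succ) → (∀ j, ψ (a j) = 0) →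
      ψ (List.ofFn a).prod = 0 ∧ φ (List.ofFn a).prod = ∏ j, φ (a j)

/-- `{X(t), 0 ≤ t ≤ T}` is a process with two-state freely independent increments. Only the values
of `X` on `[0, T]` matter. -/
structure HasTwoStateFreeIncrements (φ ψ : A →ₗ[ℂ] ℂ) (T : ℝ) (X : ℝ → A) : Prop where
  selfAdjoint : ∀ t ∈ Set.Icc 0 T, IsSelfAdjoint (X t)
  zero : X 0 = 0
  /-- The increments over finitely many pairwise disjoint intervals `[s i, t i)` are two-state
  freely independent (that is, the unital algebras they generate are). -/
  free : ∀ (k : ℕ) (s t : Fin k → ℝ), (∀ i, 0 ≤ s i ∧ s i ≤ t i ∧ t i ≤ T) →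
    (∀ i j, i ≠ j → Disjoint (Set.Ico (s i) (t i)) (Set.Ico (s j) (t j))) →
    IsTwoStateFree φ ψ fun i => Algebra.adjoin ℂ {X (t i) - X (s i)}
  mean_zero : ∀ t ∈ Set.Icc 0 T, φ (X t) = 0
  stationary : ∀ s t h : ℝ, 0 ≤ s → s ≤ t → 0 ≤ h → t + h ≤ T → ∀ n : ℕ,
    φ ((X (t + h) - X (s + h)) ^ n) = φ ((X t - X s) ^ n) ∧
    ψ ((X (t + h) - X (s + h)) ^ n) = ψ ((X t - X s) ^ n)

/-- `x` has a two-state normal distribution. -/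
def IsTwoStateNormal (φ ψ : A →ₗ[ℂ] ℂ) (x : A) : Prop :=
  ∀ n : ℕ, 2 < n → twoStateCumulantOf φ ψ n x = 0

/-- An algebraic two-state free Brownian motion on `[0, T]`. -/
structure IsAlgebraicTwoStateFreeBM (φ ψ : A →ₗ[ℂ] ℂ) (T : ℝ) (X : ℝ → A) : Prop
    extends HasTwoStateFreeIncrements φ ψ T X where
  normal : ∀ s t : ℝ, 0 ≤ s → s ≤ t → t ≤ T → IsTwoStateNormal φ ψ (X t - X s)
  variance : ∀ s t : ℝ, 0 ≤ s → s ≤ t → t ≤ T →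
    φ ((X t - X s) ^ 2) = ((t - s : ℝ) : ℂ)

/-- A two-state free Brownian motion with parameter `α` on `[0, T]`: an algebraic two-state free
Brownian motion with `R^ψ_1(X(t)) = α t`, `R^ψ_2(X(t)) = R^{φ,ψ}_2(X(t)) = t`, and
`R^ψ_k(X(t)) = 0` for `k > 2`. -/
structure IsTwoStateFreeBM (φ ψ : A →ₗ[ℂ] ℂ) (T : ℝ) (X : ℝ → A) (α : ℝ) : Prop
    extends IsAlgebraicTwoStateFreeBM φ ψ T X where
  cumulant_one : ∀ t ∈ Set.Icc 0 T, freeCumulantOf ψ 1 (X t) = ((α * t : ℝ) : ℂ)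
  cumulant_two : ∀ t ∈ Set.Icc 0 T, freeCumulantOf ψ 2 (X t) = (t : ℂ) ∧
    twoStateCumulantOf φ ψ 2 (X t) = (t : ℂ)
  cumulant_higher : ∀ k : ℕ, 2 < k → ∀ t ∈ Set.Icc 0 T, freeCumulantOf ψ k (X t) = 0

/-- The sums `∑_{i=1}^N (X(iT/N) - X((i-1)T/N))^k`, whose limit is `∫_0^T (dX(t))^k`. -/
def variationSum (T : ℝ) (X : ℝ → A) (k N : ℕ) : A :=
  ∑ i ∈ Finset.range N, (X (((i : ℝ) + 1) / N * T) - X ((i : ℝ) / N * T)) ^ k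

end Processes

end TwoStateFree

end

/-!
Given a sequence `r`, let `1 + ∑ₙ≥₁ wₙ zⁿ` be the inverse of `1 + ∑ₖ≥₁ rₖ zᵏ - x z`. Expanding
`xⁿ` in the `wₙ` indexes the terms by non-crossing partitions of `{1, …, n}` with one outer block,
possibly empty, left open. Hence `r` is the sequence of free cumulants of `x` if and only if all
`wₙ` are centered. The polynomials `wₙ` of a sum of two free elements are sums of alternating
products of those of the summands, hence centered: free cumulants are additive on free elements.

For a process with stationary free increments, `t ↦ R^ψ_n(X(t))` is therefore additive on `[0, T]`,
and linear if it is nonnegative. Moreover `ψ` of the `k`-th variation sum is `N ψ[X(T/N)ᵏ]`. In the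
moment-cumulant formula for this only the one-block partition survives as `N → ∞`, and the limit is
`R^ψ_k(X(T))`. The limits of the variation sums thus give `R^ψ_2(X(T)) = T` and `R^ψ_k(X(T)) = 0`
for `k > 2`.
-/

noncomputable section

namespace TwoStateFree

section OpenPartitions

variable {α M : Type*} [LinearOrder α] [AddCommMonoid M]

/-- `Q` is a non-crossing partition of `s \ O` no block of which surrounds an element of `O`: the
elements of `O` stay open, i.e. available for blocks that end to the right of `s`. -/
structure IsOpenNC (s O : Finset α) (Q : Finset (Finset α)) : Prop where
  open_subset : O ⊆ s
  nonempty : ∀ V ∈ Q, V.Nonempty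
  mem_block_iff : ∀ x, (∃ V ∈ Q, x ∈ V) ↔ x ∈ s ∧ x ∉ O
  eq_of_mem : ∀ U ∈ Q, ∀ V ∈ Q, ∀ x ∈ U, x ∈ V → U = V
  noncrossing : ∀ U ∈ Q, ∀ V ∈ Q, ∀ x₁ ∈ U, ∀ y₁ ∈ V, ∀ x₂ ∈ U, ∀ y₂ ∈ V,
    x₁ < y₁ → y₁ < x₂ → x₂ < y₂ → U = V
  not_between : ∀ V ∈ Q, ∀ x ∈ V, ∀ y ∈ V, ∀ o ∈ O, x < o → ¬ o < y

open Classical in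
/-- The finite set of pairs `(O, Q)` with `IsOpenNC s O Q`. -/
def openNC (s : Finset α) : Finset (Finset α × Finset (Finset α)) :=
  {p ∈ s.powerset ×ˢ s.powerset.powerset | IsOpenNC s p.1 p.2}

/-- The upward closed subsets of `O`, one of each cardinality up to that of `O`. -/
def topSubsets (O : Finset α) : Finset (Finset α) :=
  {K ∈ O.powerset | ∀ y ∈ K, ∀ x ∈ O, y ≤ x → x ∈ K}

variable {s O K V : Finset α} {Q : Finset (Finset α)} {m : α}

lemma mem_topSubsets : K ∈ topSubsets O ↔ K ⊆ O ∧ ∀ y ∈ K, ∀ x ∈ O, y ≤ x → x ∈ K := by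
  simp [topSubsets]

lemma topSubsets_insert (hm : ∀ x ∈ O, m < x) :
    topSubsets (insert m O) = insert (insert m O) (topSubsets O) := by
  ext K
  simp only [mem_topSubsets, Finset.mem_insert]
  constructor
  · rintro ⟨hKO, hK⟩
    by_cases hmK : m ∈ K
    · refine Or.inl (hKO.antisymm fun x hx => ?_)
      rcases Finset.mem_insert.1 hx with rfl | hxO
      · exact hmK
      · exact hK m hmK x (Or.inr hxO) (hm x hxO).le
    · exact Or.inr ⟨(Finset.subset_insert_iff_of_notMem hmK).1 hKO,
        fun y hy x hx => hK y hy x (Or.inr hx)⟩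
  · rintro (rfl | ⟨hKO, hK⟩)
    · exact ⟨subset_rfl, fun _ _ x hx _ => Finset.mem_insert.2 hx⟩
    · refine ⟨hKO.trans (Finset.subset_insert m O), fun y hy x hx hyx => ?_⟩
      rcases hx with rfl | hx
      · exact absurd hyx (hm y (hKO hy)).not_ge
      · exact hK y hy x hx hyx

lemma sum_topSubsets (O : Finset α) (f : ℕ → M) :
    ∑ K ∈ topSubsets O, f K.card = ∑ k ∈ Finset.range (O.card + 1), f k := by
  induction O using Finset.induction_on_min with
  | empty => simp [topSubsets]
  | insert m O hm ih =>
    have hmO : m ∉ O := fun h => lt_irrefl m (hm m h)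
    have hnotMem : insert m O ∉ topSubsets O := by
      simp [topSubsets, Finset.insert_subset_iff, hmO]
    rw [topSubsets_insert hm, Finset.sum_insert hnotMem, ih, Finset.card_insert_of_notMem hmO,
      Finset.sum_range_succ _ (O.card + 1), add_comm]

namespace IsOpenNC

lemma mem_of_mem_block (h : IsOpenNC s O Q) (hV : V ∈ Q) {x : α} (hx : x ∈ V) : x ∈ s :=
  ((h.mem_block_iff x).1 ⟨V, hV, hx⟩).1

lemma notMem_of_mem_block (h : IsOpenNC s O Q) (hV : V ∈ Q) {x : α} (hx : x ∈ V) : x ∉ O :=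
  ((h.mem_block_iff x).1 ⟨V, hV, hx⟩).2

lemma self_empty (s : Finset α) : IsOpenNC s s ∅ := by
  constructor <;> simp

lemma eq_empty (h : IsOpenNC s s Q) : Q = ∅ := by
  refine Finset.eq_empty_of_forall_notMem fun V hV => ?_
  obtain ⟨x, hx⟩ := h.nonempty V hV
  exact h.notMem_of_mem_block hV hx (h.mem_of_mem_block hV hx)

end IsOpenNC

lemma mem_openNC {p : Finset α × Finset (Finset α)} :
    p ∈ openNC s ↔ IsOpenNC s p.1 p.2 := by
  simp only [openNC, Finset.mem_filter, Finset.mem_product, Finset.mem_powerset,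
    and_iff_right_iff_imp]
  exact fun h => ⟨h.open_subset, fun V hV =>
    Finset.mem_powerset.2 fun _ => h.mem_of_mem_block hV⟩

lemma openNC_empty : openNC (∅ : Finset α) = {(∅, ∅)} := by
  ext ⟨O, Q⟩
  simp only [mem_openNC, Finset.mem_singleton, Prod.mk.injEq]
  constructor
  · intro h
    obtain rfl := Finset.subset_empty.1 h.open_subset
    exact ⟨rfl, h.eq_empty⟩
  · rintro ⟨rfl, rfl⟩
    exact .self_empty ∅

lemma isOpenNC_insert_insert_iff (hm : ∀ x ∈ s, x < m) (hmO : m ∉ O) :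
    IsOpenNC (insert m s) (insert m O) Q ↔ IsOpenNC s O Q := by
  have hms : m ∉ s := fun h => lt_irrefl m (hm m h)
  have mem_iff (x : α) : x ∈ insert m s ∧ x ∉ insert m O ↔ x ∈ s ∧ x ∉ O := by
    simp only [Finset.mem_insert]
    grind
  constructor <;> intro h
  · exact ⟨(Finset.insert_subset_insert_iff hmO).1 h.open_subset, h.nonempty,
      fun x => (h.mem_block_iff x).trans (mem_iff x), h.eq_of_mem, h.noncrossing,
      fun V hV x hx y hy o ho => h.not_between V hV x hx y hy o (Finset.mem_insert_of_mem ho)⟩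
  · refine ⟨Finset.insert_subset_insert m h.open_subset, h.nonempty,
      fun x => (h.mem_block_iff x).trans (mem_iff x).symm, h.eq_of_mem, h.noncrossing, ?_⟩
    intro V hV x hx y hy o ho hxo hoy
    rcases Finset.mem_insert.1 ho with rfl | ho
    · exact lt_asymm hoy (hm y (h.mem_of_mem_block hV hy))
    · exact h.not_between V hV x hx y hy o ho hxo hoy

lemma IsOpenNC.noncrossing_insert (hm : ∀ x ∈ s, x < m) (h : IsOpenNC s O Q) (hKO : K ⊆ O) :
    ∀ U ∈ insert (insert m K) Q, ∀ V ∈ insert (insert m K) Q, ∀ x₁ ∈ U, ∀ y₁ ∈ V, ∀ x₂ ∈ U,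
      ∀ y₂ ∈ V, x₁ < y₁ → y₁ < x₂ → x₂ < y₂ → U = V := by
  intro U hU V hV x₁ hx₁ y₁ hy₁ x₂ hx₂ y₂ hy₂ h₁ h₂ h₃
  rcases Finset.mem_insert.1 hU with rfl | hUQ <;> rcases Finset.mem_insert.1 hV with rfl | hVQ
  · rfl
  · rcases Finset.mem_insert.1 hx₂ with rfl | hx₂
    · exact absurd h₃ (hm y₂ (h.mem_of_mem_block hVQ hy₂)).not_gt
    · exact absurd h₃ (h.not_between V hVQ y₁ hy₁ y₂ hy₂ x₂ (hKO hx₂) h₂)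
  · rcases Finset.mem_insert.1 hy₁ with rfl | hy₁
    · exact absurd h₂ (hm x₂ (h.mem_of_mem_block hUQ hx₂)).not_gt
    · exact absurd h₂ (h.not_between U hUQ x₁ hx₁ x₂ hx₂ y₁ (hKO hy₁) h₁)
  · exact h.noncrossing U hUQ V hVQ x₁ hx₁ y₁ hy₁ x₂ hx₂ y₂ hy₂ h₁ h₂ h₃

lemma IsOpenNC.close (hm : ∀ x ∈ s, x < m) (h : IsOpenNC s O Q) (hK : K ∈ topSubsets O) :
    IsOpenNC (insert m s) (O \ K) (insert (insert m K) Q) := by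
  obtain ⟨hKO, hK⟩ := mem_topSubsets.1 hK
  have hms : m ∉ s := fun h => lt_irrefl m (hm m h)
  have hdisj : ∀ V ∈ Q, ∀ x ∈ V, x ∉ insert m K := by
    intro V hV x hx hxK
    rcases Finset.mem_insert.1 hxK with rfl | hxK
    · exact hms (h.mem_of_mem_block hV hx)
    · exact h.notMem_of_mem_block hV hx (hKO hxK)
  refine ⟨(Finset.sdiff_subset.trans h.open_subset).trans (Finset.subset_insert m s), ?_, ?_, ?_,
    h.noncrossing_insert hm hKO, ?_⟩
  · exact (Finset.forall_mem_insert _ _ _).2 ⟨Finset.insert_nonempty m K, h.nonempty⟩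
  · intro x
    rw [Finset.exists_mem_insert, h.mem_block_iff]
    have hKO := @hKO x
    have hOs := @h.open_subset x
    simp only [Finset.mem_insert, Finset.mem_sdiff]
    grind
  · intro U hU V hV x hxU hxV
    rcases Finset.mem_insert.1 hU with rfl | hU <;> rcases Finset.mem_insert.1 hV with rfl | hV
    · rfl
    · exact absurd hxU (hdisj V hV x hxV)
    · exact absurd hxV (hdisj U hU x hxU)
    · exact h.eq_of_mem U hU V hV x hxU hxV
  · intro V hV x hx y hy o ho hxo hoy
    obtain ⟨hoO, hoK⟩ := Finset.mem_sdiff.1 ho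
    rcases Finset.mem_insert.1 hV with rfl | hV
    · rcases Finset.mem_insert.1 hx with rfl | hx
      · exact lt_asymm hxo (hm o (h.open_subset hoO))
      · exact hoK (hK x hx o hoO hxo.le)
    · exact h.not_between V hV x hx y hy o hoO hxo hoy

lemma IsOpenNC.close_injective (hm : ∀ x ∈ s, x < m) {O₁ O₂ K₁ K₂ : Finset α}
    {Q₁ Q₂ : Finset (Finset α)} (h₁ : IsOpenNC s O₁ Q₁) (h₂ : IsOpenNC s O₂ Q₂)
    (hK₁ : K₁ ∈ topSubsets O₁) (hK₂ : K₂ ∈ topSubsets O₂) (hO : O₁ \ K₁ = O₂ \ K₂)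
    (hQ : insert (insert m K₁) Q₁ = insert (insert m K₂) Q₂) :
    O₁ = O₂ ∧ Q₁ = Q₂ ∧ K₁ = K₂ := by
  have hms : m ∉ s := fun h => lt_irrefl m (hm m h)
  have hKO₁ := (mem_topSubsets.1 hK₁).1
  have hKO₂ := (mem_topSubsets.1 hK₂).1
  have hmK₁ : m ∉ K₁ := fun h => hms (h₁.open_subset (hKO₁ h))
  have hmK₂ : m ∉ K₂ := fun h => hms (h₂.open_subset (hKO₂ h))
  have hmQ₁ : insert m K₁ ∉ Q₁ := fun h =>
    hms (h₁.mem_of_mem_block h (Finset.mem_insert_self m K₁))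
  have hmQ₂ : insert m K₂ ∉ Q₂ := fun h =>
    hms (h₂.mem_of_mem_block h (Finset.mem_insert_self m K₂))
  have hmK : insert m K₁ = insert m K₂ := (h₂.close hm hK₂).eq_of_mem _
    (hQ ▸ Finset.mem_insert_self _ Q₁) _ (Finset.mem_insert_self _ Q₂) m
    (Finset.mem_insert_self m K₁) (Finset.mem_insert_self m K₂)
  obtain rfl : K₁ = K₂ := by
    rw [← Finset.erase_insert hmK₁, hmK, Finset.erase_insert hmK₂]
  refine ⟨?_, ?_, rfl⟩
  · rw [← Finset.sdiff_union_of_subset hKO₁, hO, Finset.sdiff_union_of_subset hKO₂]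
  · rw [← Finset.erase_insert hmQ₁, hQ, Finset.erase_insert hmQ₂]

lemma IsOpenNC.erase_mem_topSubsets (hm : ∀ x ∈ s, x < m) (h : IsOpenNC (insert m s) O Q)
    (hmO : m ∉ O) (hV : V ∈ Q) (hmV : m ∈ V) : V.erase m ∈ topSubsets (O ∪ V.erase m) := by
  refine mem_topSubsets.2 ⟨Finset.subset_union_right, fun y hy x hx hyx => ?_⟩
  have hyV := Finset.mem_of_mem_erase hy
  refine (Finset.mem_union.1 hx).resolve_left fun hxO => ?_
  have hxm : x < m :=
    hm x (Finset.mem_of_mem_insert_of_ne (h.open_subset hxO) (ne_of_mem_of_not_mem hxO hmO))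
  have hyx : y < x := hyx.lt_of_ne fun e => h.notMem_of_mem_block hV hyV (e ▸ hxO)
  exact h.not_between V hV y hyV m hmV x hxO hyx hxm

lemma IsOpenNC.reopen (hm : ∀ x ∈ s, x < m) (h : IsOpenNC (insert m s) O Q) (hmO : m ∉ O)
    (hV : V ∈ Q) (hmV : m ∈ V) :
    IsOpenNC s (O ∪ V.erase m) (Q.erase V) := by
  have hms : m ∉ s := fun h => lt_irrefl m (hm m h)
  have mem_of_ne {x : α} (hx : x ∈ insert m s) (hxm : x ≠ m) : x ∈ s :=
    Finset.mem_of_mem_insert_of_ne hx hxm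
  have hQ {U : Finset α} (hU : U ∈ Q.erase V) : U ∈ Q := Finset.mem_of_mem_erase hU
  have hdisj {U : Finset α} (hU : U ∈ Q.erase V) {x : α} (hxU : x ∈ U) : x ∉ V :=
    fun hxV => Finset.ne_of_mem_erase hU (h.eq_of_mem U (hQ hU) V hV x hxU hxV)
  have mem_of_block {U : Finset α} (hU : U ∈ Q.erase V) {x : α} (hxU : x ∈ U) : x ∈ s :=
    mem_of_ne (h.mem_of_mem_block (hQ hU) hxU) fun e => hdisj hU hxU (e ▸ hmV)
  refine ⟨fun x hx => ?_, fun U hU => h.nonempty U (hQ hU), fun x => ⟨?_, ?_⟩,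
    fun U hU W hW => h.eq_of_mem U (hQ hU) W (hQ hW),
    fun U hU W hW => h.noncrossing U (hQ hU) W (hQ hW), fun U hU x hx y hy o ho hxo hoy => ?_⟩
  · rcases Finset.mem_union.1 hx with hx | hx
    · exact mem_of_ne (h.open_subset hx) (ne_of_mem_of_not_mem hx hmO)
    · exact mem_of_ne (h.mem_of_mem_block hV (Finset.mem_of_mem_erase hx))
        (Finset.ne_of_mem_erase hx)
  · rintro ⟨U, hU, hxU⟩
    simp only [Finset.mem_union, Finset.mem_erase, not_or, not_and]
    exact ⟨mem_of_block hU hxU, h.notMem_of_mem_block (hQ hU) hxU, fun _ => hdisj hU hxU⟩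
  · rintro ⟨hxs, hx⟩
    simp only [Finset.mem_union, Finset.mem_erase, not_or, not_and] at hx
    obtain ⟨U, hU, hxU⟩ := (h.mem_block_iff x).2 ⟨Finset.mem_insert_of_mem hxs, hx.1⟩
    have hUV : U ≠ V := fun e => hx.2 (ne_of_mem_of_not_mem hxs hms) (e ▸ hxU)
    exact ⟨U, Finset.mem_erase.2 ⟨hUV, hU⟩, hxU⟩
  · rcases Finset.mem_union.1 ho with ho | ho
    · exact h.not_between U (hQ hU) x hx y hy o ho hxo hoy
    · have hym := hm y (mem_of_block hU hy)
      exact Finset.ne_of_mem_erase hU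
        (h.noncrossing U (hQ hU) V hV x hx o (Finset.mem_of_mem_erase ho) y hy m hmV hxo hoy hym)

lemma sum_openNC_insert_filter_mem (hm : ∀ x ∈ s, x < m)
    (f : Finset α × Finset (Finset α) → M) :
    ∑ q ∈ openNC (insert m s) with m ∈ q.1, f q = ∑ p ∈ openNC s, f (insert m p.1, p.2) := by
  have hmO {p : Finset α × Finset (Finset α)} (hp : p ∈ openNC s) : m ∉ p.1 := fun h =>
    lt_irrefl m (hm m ((mem_openNC.1 hp).open_subset h))
  refine (Finset.sum_bij (fun p _ => (insert m p.1, p.2)) (fun p hp => ?_)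
    (fun p hp q hq e => ?_) (fun q hq => ?_) fun _ _ => rfl).symm
  · simp only [Finset.mem_filter, mem_openNC, Finset.mem_insert_self, and_true]
    exact (isOpenNC_insert_insert_iff hm (hmO hp)).2 (mem_openNC.1 hp)
  · obtain ⟨h₁, h₂⟩ := Prod.mk.inj e
    exact Prod.ext (by rw [← Finset.erase_insert (hmO hp), h₁, Finset.erase_insert (hmO hq)]) h₂
  · obtain ⟨hq, hmq⟩ := Finset.mem_filter.1 hq
    have h := mem_openNC.1 hq
    rw [← Finset.insert_erase hmq,
      isOpenNC_insert_insert_iff hm (Finset.notMem_erase m q.1)] at h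
    exact ⟨(q.1.erase m, q.2), mem_openNC.2 h, by rw [Finset.insert_erase hmq]⟩

/-- When `m` is not left open, its block consists of `m` and a topmost set of elements that were
open before `m`. -/
lemma sum_openNC_insert_filter_notMem (hm : ∀ x ∈ s, x < m)
    (f : Finset α × Finset (Finset α) → M) :
    ∑ q ∈ openNC (insert m s) with m ∉ q.1, f q =
      ∑ p ∈ openNC s, ∑ K ∈ topSubsets p.1, f (p.1 \ K, insert (insert m K) p.2) := by
  have hms : m ∉ s := fun h => lt_irrefl m (hm m h)
  rw [Finset.sum_sigma']
  refine (Finset.sum_bij (fun p _ => (p.1.1 \ p.2, insert (insert m p.2) p.1.2)) ?_ ?_ ?_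
    fun _ _ => rfl).symm
  · rintro ⟨p, K⟩ hp
    obtain ⟨hp, hK⟩ := Finset.mem_sigma.1 hp
    have h := mem_openNC.1 hp
    exact Finset.mem_filter.2 ⟨mem_openNC.2 (h.close hm hK), fun hmO =>
      hms (h.open_subset (Finset.mem_sdiff.1 hmO).1)⟩
  · rintro ⟨⟨O₁, Q₁⟩, K₁⟩ hp₁ ⟨⟨O₂, Q₂⟩, K₂⟩ hp₂ e
    obtain ⟨hp₁, hK₁⟩ := Finset.mem_sigma.1 hp₁
    obtain ⟨hp₂, hK₂⟩ := Finset.mem_sigma.1 hp₂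
    obtain ⟨eO, eQ⟩ := Prod.mk.inj e
    obtain ⟨rfl, rfl, rfl⟩ :=
      (mem_openNC.1 hp₁).close_injective hm (mem_openNC.1 hp₂) hK₁ hK₂ eO eQ
    rfl
  · rintro ⟨O, Q⟩ hq
    obtain ⟨hq, hmO⟩ := Finset.mem_filter.1 hq
    have h := mem_openNC.1 hq
    obtain ⟨V, hV, hmV⟩ := (h.mem_block_iff m).2 ⟨Finset.mem_insert_self m s, hmO⟩
    refine ⟨⟨(O ∪ V.erase m, Q.erase V), V.erase m⟩, Finset.mem_sigma.2
      ⟨mem_openNC.2 (h.reopen hm hmO hV hmV), h.erase_mem_topSubsets hm hmO hV hmV⟩, ?_⟩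
    have hdisj : Disjoint O (V.erase m) := Finset.disjoint_right.2 fun x hx =>
      h.notMem_of_mem_block hV (Finset.mem_of_mem_erase hx)
    simp only [Finset.union_sdiff_cancel_right hdisj, Finset.insert_erase hmV,
      Finset.insert_erase hV]

lemma sum_openNC_insert (hm : ∀ x ∈ s, x < m) (f : Finset α × Finset (Finset α) → M) :
    ∑ q ∈ openNC (insert m s), f q = ∑ p ∈ openNC s, f (insert m p.1, p.2) +
      ∑ p ∈ openNC s, ∑ K ∈ topSubsets p.1, f (p.1 \ K, insert (insert m K) p.2) := by
  rw [← sum_openNC_insert_filter_mem hm, ← sum_openNC_insert_filter_notMem hm,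
    Finset.sum_filter_add_sum_filter_not]

lemma mem_NC {n : ℕ} {P : Finpartition (Finset.univ : Finset (Fin n))} :
    P ∈ NC n ↔ IsNonCrossing P := by
  simp [NC]

lemma isOpenNC_univ_empty_iff {n : ℕ} {Q : Finset (Finset (Fin n))} :
    IsOpenNC Finset.univ ∅ Q ↔ ∃ P ∈ NC n, P.parts = Q := by
  constructor
  · intro h
    have existsUnique_block (x : Fin n) (_ : x ∈ Finset.univ) : ∃! V, V ∈ Q ∧ x ∈ V := by
      obtain ⟨V, hV, hxV⟩ := (h.mem_block_iff x).2 ⟨Finset.mem_univ x, Finset.notMem_empty x⟩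
      exact ⟨V, ⟨hV, hxV⟩, fun U hU => h.eq_of_mem U hU.1 V hV x hU.2 hxV⟩
    refine ⟨.ofExistsUnique Q (fun V _ => Finset.subset_univ V) existsUnique_block
      fun hQ => Finset.not_nonempty_empty (h.nonempty ∅ hQ), ?_, rfl⟩
    exact mem_NC.2 h.noncrossing
  · rintro ⟨P, hP, rfl⟩
    exact ⟨Finset.empty_subset _, fun V => P.nonempty_of_mem_parts,
      fun x => by simpa using P.exists_mem (Finset.mem_univ x),
      fun U hU V hV x hxU hxV => P.eq_of_mem_parts hU hV hxU hxV, mem_NC.1 hP, by simp⟩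

lemma sum_openNC_univ_filter_eq_empty (n : ℕ) (f : Finset (Finset (Fin n)) → M) :
    ∑ p ∈ openNC (Finset.univ : Finset (Fin n)) with p.1 = ∅, f p.2 =
      ∑ P ∈ NC n, f P.parts := by
  refine (Finset.sum_bij (fun P _ => (∅, P.parts)) (fun P hP => ?_)
    (fun P _ Q _ h => Finpartition.ext (Prod.mk.inj h).2) ?_ fun _ _ => rfl).symm
  · exact Finset.mem_filter.2 ⟨mem_openNC.2 (isOpenNC_univ_empty_iff.2 ⟨P, hP, rfl⟩), rfl⟩
  · rintro ⟨O, Q⟩ hp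
    obtain ⟨hp, rfl : O = ∅⟩ := Finset.mem_filter.1 hp
    obtain ⟨P, hP, rfl⟩ := isOpenNC_univ_empty_iff.1 (mem_openNC.1 hp)
    exact ⟨P, hP, rfl⟩

end OpenPartitions

section Wick

variable {R A : Type*} [CommRing R] [Ring A] [Algebra R A]

/-- The power series `1 + ∑ₖ r_k zᵏ - x z`, the inverse of `wickSeries r x`. -/
def wickInv (r : ℕ → R) (x : A) : PowerSeries A :=
  1 + PowerSeries.X * (PowerSeries.mk (fun k => algebraMap R A (r (k + 1))) - PowerSeries.C x)

/-- The generating function `(1 + ∑ₖ r_k zᵏ - x z)⁻¹` of the Wick polynomials of `x`. -/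
def wickSeries (r : ℕ → R) (x : A) : PowerSeries A := (wickInv r x).invOfUnit 1

/-- The `n`-th free Wick polynomial of `x`, for prospective cumulants `r` (the value `r 0` is
ignored). When `r` is the sequence of free cumulants of `x`, these are centered for `n ≠ 0`. -/
def wick (r : ℕ → R) (x : A) (n : ℕ) : A := PowerSeries.coeff n (wickSeries r x)

lemma constantCoeff_wickInv (r : ℕ → R) (x : A) :
    PowerSeries.constantCoeff (wickInv r x) = 1 := by
  simp [wickInv]

lemma wickInv_mul_wickSeries (r : ℕ → R) (x : A) : wickInv r x * wickSeries r x = 1 :=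
  PowerSeries.mul_invOfUnit _ _ (by simp [constantCoeff_wickInv])

lemma wickSeries_mul_wickInv (r : ℕ → R) (x : A) : wickSeries r x * wickInv r x = 1 :=
  PowerSeries.invOfUnit_mul _ _ (by simp [constantCoeff_wickInv])

lemma wickInv_add (r s : ℕ → R) (x y : A) :
    wickInv (r + s) (x + y) = wickInv r x + wickInv s y - 1 := by
  have mk_add : (PowerSeries.mk fun k => algebraMap R A ((r + s) (k + 1))) =
      (PowerSeries.mk fun k => algebraMap R A (r (k + 1))) +
        PowerSeries.mk fun k => algebraMap R A (s (k + 1)) := by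
    ext n
    simp
  rw [wickInv, wickInv, wickInv, mk_add, map_add]
  noncomm_ring

lemma wick_zero (r : ℕ → R) (x : A) : wick r x 0 = 1 := by
  simp [wick, wickSeries]

lemma mul_wick (r : ℕ → R) (x : A) (n : ℕ) :
    x * wick r x n =
      wick r x (n + 1) + ∑ k ∈ Finset.range (n + 1), r (k + 1) • wick r x (n - k) := by
  have h := congrArg (PowerSeries.coeff (n + 1)) (wickInv_mul_wickSeries r x)
  rw [wickInv, add_mul, one_mul, mul_assoc, map_add, PowerSeries.coeff_succ_X_mul, sub_mul, map_sub,
    PowerSeries.coeff_C_mul, PowerSeries.coeff_mul, PowerSeries.coeff_one, if_neg n.succ_ne_zero,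
    Finset.Nat.sum_antidiagonal_eq_sum_range_succ_mk] at h
  simp only [PowerSeries.coeff_mk, ← Algebra.smul_def] at h
  rw [← add_sub_assoc, sub_eq_zero] at h
  exact h.symm

lemma wick_mem (r : ℕ → R) {x : A} {B : Subalgebra R A} (hx : x ∈ B) (n : ℕ) :
    wick r x n ∈ B := by
  induction n using Nat.strong_induction_on with
  | _ n ih =>
    cases n with
    | zero => exact wick_zero r x ▸ one_mem B
    | succ n =>
      rw [← sub_eq_of_eq_add (mul_wick r x n)]
      refine sub_mem (mul_mem hx (ih n n.lt_succ_self)) (sum_mem fun k _ => ?_)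
      exact B.smul_mem (ih _ (by lia)) _

lemma pow_card_eq_sum_openNC {α : Type*} [LinearOrder α] (r : ℕ → R) (x : A) (s : Finset α) :
    x ^ s.card = ∑ p ∈ openNC s, (∏ V ∈ p.2, r V.card) • wick r x p.1.card := by
  induction s using Finset.induction_on_max with
  | empty => simp [openNC_empty, wick_zero]
  | insert m s hm ih =>
    have hms : m ∉ s := fun h => lt_irrefl m (hm m h)
    rw [Finset.card_insert_of_notMem hms, pow_succ', ih, Finset.mul_sum, sum_openNC_insert hm,
      ← Finset.sum_add_distrib]
    refine Finset.sum_congr rfl fun p hp => ?_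
    have h := mem_openNC.1 hp
    have hmO : m ∉ p.1 := fun hmO => hms (h.open_subset hmO)
    rw [mul_smul_comm, mul_wick, smul_add, Finset.card_insert_of_notMem hmO,
      ← sum_topSubsets p.1 fun k => r (k + 1) • wick r x (p.1.card - k), Finset.smul_sum]
    congr 1
    refine Finset.sum_congr rfl fun K hK => ?_
    have hKO := (mem_topSubsets.1 hK).1
    have hmQ : insert m K ∉ p.2 := fun hV =>
      hms (h.mem_of_mem_block hV (Finset.mem_insert_self m K))
    rw [Finset.prod_insert hmQ, Finset.card_insert_of_notMem fun hmK => hmO (hKO hmK),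
      Finset.card_sdiff_of_subset hKO, smul_smul, mul_comm]

lemma map_pow_eq_sum_NC_add {ψ : A →ₗ[R] R} (hψ : ψ 1 = 1) (r : ℕ → R) (x : A) (n : ℕ) :
    ψ (x ^ n) = ∑ P ∈ NC n, ∏ V ∈ P.parts, r V.card +
      ∑ p ∈ openNC (Finset.univ : Finset (Fin n)) with p.1 ≠ ∅,
        (∏ V ∈ p.2, r V.card) * ψ (wick r x p.1.card) := by
  have h := congrArg ψ (pow_card_eq_sum_openNC r x (Finset.univ : Finset (Fin n)))
  rw [Finset.card_fin] at h
  simp only [map_sum, map_smul, smul_eq_mul] at h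
  rw [h, ← Finset.sum_filter_add_sum_filter_not _ (fun p => p.1 = ∅),
    ← sum_openNC_univ_filter_eq_empty n fun Q => ∏ V ∈ Q, r V.card]
  refine congrArg (· + _) (Finset.sum_congr rfl fun p hp => ?_)
  rw [(Finset.mem_filter.1 hp).2, Finset.card_empty, wick_zero, hψ, mul_one]

lemma map_wick_eq_zero_iff_map_pow {ψ : A →ₗ[R] R} (hψ : ψ 1 = 1) (r : ℕ → R) (x : A) :
    (∀ n ≠ 0, ψ (wick r x n) = 0) ↔
      ∀ n ≠ 0, ψ (x ^ n) = ∑ P ∈ NC n, ∏ V ∈ P.parts, r V.card := by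
  constructor
  · intro hwick n _
    rw [map_pow_eq_sum_NC_add hψ r, add_eq_left]
    refine Finset.sum_eq_zero fun p hp => ?_
    rw [hwick _ (Finset.card_ne_zero.2 (Finset.nonempty_iff_ne_empty.2 (Finset.mem_filter.1 hp).2)),
      mul_zero]
  · intro hmoments n
    induction n using Nat.strong_induction_on with
    | _ n ih =>
      intro hn
      have : NeZero n := ⟨hn⟩
      have h := map_pow_eq_sum_NC_add hψ r x n
      rw [hmoments n hn, left_eq_add, Finset.sum_eq_single (Finset.univ, ∅)] at h
      · simpa using h
      · rintro ⟨O, Q⟩ hp hne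
        obtain ⟨hp, hO : O ≠ ∅⟩ := Finset.mem_filter.1 hp
        have hOuniv : O ≠ Finset.univ := by
          rintro rfl
          exact hne (Prod.ext rfl (mem_openNC.1 hp).eq_empty)
        have hlt : O.card < n := by
          simpa using Finset.card_lt_card (Finset.ssubset_univ_iff.2 hOuniv)
        rw [ih _ hlt (Finset.card_ne_zero.2 (Finset.nonempty_iff_ne_empty.2 hO)), mul_zero]
      · exact fun h => absurd (Finset.mem_filter.2
          ⟨mem_openNC.2 (.self_empty _), Finset.univ_nonempty.ne_empty⟩) h

end Wick

section FreeCumulants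

variable {A : Type*} [Ring A] [Algebra ℂ A] {φ ψ : A →ₗ[ℂ] ℂ} {x y : A}

lemma card_lt_of_mem_properNC {n : ℕ} {P : Finpartition (Finset.univ : Finset (Fin n))}
    (hP : P ∈ properNC n) {V : Finset (Fin n)} (hV : V ∈ P.parts) : V.card < n :=
  (Finset.mem_filter.1 hP).2 V hV

lemma moment_const (ψ : A →ₗ[ℂ] ℂ) (n : ℕ) (x : A) :
    moment ψ (fun _ : Fin n => x) = ψ (x ^ n) := by
  simp [moment]

lemma freeCumulantOf_eq_map_pow_sub (ψ : A →ₗ[ℂ] ℂ) (n : ℕ) (x : A) :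
    freeCumulantOf ψ n x =
      ψ (x ^ n) - ∑ P ∈ properNC n, ∏ V ∈ P.parts, freeCumulantOf ψ V.card x := by
  rw [freeCumulantOf, freeCumulant, moment_const]
  refine congrArg (_ - ·) (Finset.sum_congr rfl fun P hP => Finset.prod_congr rfl fun V hV => ?_)
  exact dif_pos (card_lt_of_mem_properNC hP hV)

lemma freeCumulantOf_congr (h : ∀ n, ψ (x ^ n) = ψ (y ^ n)) (n : ℕ) :
    freeCumulantOf ψ n x = freeCumulantOf ψ n y := by
  induction n using Nat.strong_induction_on with
  | _ n ih =>
    rw [freeCumulantOf_eq_map_pow_sub, freeCumulantOf_eq_map_pow_sub, h]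
    exact congrArg (_ - ·) (Finset.sum_congr rfl fun P hP => Finset.prod_congr rfl fun V hV =>
      ih _ (card_lt_of_mem_properNC hP hV))

lemma sum_NC_prod {n : ℕ} (hn : n ≠ 0) (r : ℕ → ℂ) :
    ∑ P ∈ NC n, ∏ V ∈ P.parts, r V.card =
      r n + ∑ P ∈ properNC n, ∏ V ∈ P.parts, r V.card := by
  have hparts : (oneBlock n hn).parts = {Finset.univ} := rfl
  rw [sum_NC hn, hparts, Finset.prod_singleton, Finset.card_fin]

lemma freeCumulantOf_eq_iff_map_pow (ψ : A →ₗ[ℂ] ℂ) (r : ℕ → ℂ) (x : A) :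
    (∀ n ≠ 0, freeCumulantOf ψ n x = r n) ↔
      ∀ n ≠ 0, ψ (x ^ n) = ∑ P ∈ NC n, ∏ V ∈ P.parts, r V.card := by
  have prod_congr {n : ℕ} {f g : ℕ → ℂ} (hfg : ∀ k < n, k ≠ 0 → f k = g k) :
      ∑ P ∈ properNC n, ∏ V ∈ P.parts, f V.card = ∑ P ∈ properNC n, ∏ V ∈ P.parts, g V.card :=
    Finset.sum_congr rfl fun P hP => Finset.prod_congr rfl fun V hV =>
      hfg _ (card_lt_of_mem_properNC hP hV) (P.nonempty_of_mem_parts hV).card_ne_zero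
  constructor
  · intro hr n hn
    rw [sum_NC_prod hn, ← prod_congr fun k _ => hr k, ← hr n hn, freeCumulantOf_eq_map_pow_sub,
      sub_add_cancel]
  · intro hmoments n
    induction n using Nat.strong_induction_on with
    | _ n ih =>
      intro hn
      rw [freeCumulantOf_eq_map_pow_sub, hmoments n hn, prod_congr ih, sum_NC_prod hn,
        add_sub_cancel_right]

lemma map_wick_eq_zero_iff (hψ : ψ 1 = 1) (r : ℕ → ℂ) (x : A) :
    (∀ n ≠ 0, ψ (wick r x n) = 0) ↔ ∀ n ≠ 0, freeCumulantOf ψ n x = r n :=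
  (map_wick_eq_zero_iff_map_pow hψ r x).trans (freeCumulantOf_eq_iff_map_pow ψ r x).symm

lemma two_le_card_parts_of_mem_properNC {n : ℕ} (hn : n ≠ 0)
    {P : Finpartition (Finset.univ : Finset (Fin n))} (hP : P ∈ properNC n) :
    2 ≤ P.parts.card := by
  have : NeZero n := ⟨hn⟩
  have hpos : 0 < P.parts.card :=
    (P.parts_nonempty Finset.univ_nonempty.ne_empty).card_pos
  refine Nat.lt_of_le_of_ne hpos fun h => ?_
  obtain ⟨V, hV⟩ := Finset.card_eq_one.1 h.symm
  have hlt : V.card < n := card_lt_of_mem_properNC hP (hV ▸ Finset.mem_singleton_self V)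
  have hsum := P.sum_card_parts
  rw [hV, Finset.sum_singleton, Finset.card_fin] at hsum
  exact hlt.ne hsum

/-- A proper non-crossing partition has at least two blocks, so its contribution to the moment is
of order at most `N⁻²`. -/
lemma tendsto_natCast_mul_map_pow {x : ℕ → A} {κ : ℕ → ℂ}
    (hκ : ∀ j ≠ 0, Tendsto (fun N : ℕ => N * freeCumulantOf ψ j (x N)) atTop (𝓝 (κ j)))
    {k : ℕ} (hk : k ≠ 0) :
    Tendsto (fun N : ℕ => N * ψ (x N ^ k)) atTop (𝓝 (κ k)) := by
  have hproper (P : Finpartition (Finset.univ : Finset (Fin k))) (hP : P ∈ properNC k) :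
      Tendsto (fun N : ℕ => N * ∏ V ∈ P.parts, freeCumulantOf ψ V.card (x N)) atTop (𝓝 0) := by
    obtain ⟨c, hc⟩ := exists_add_of_le (two_le_card_parts_of_mem_properNC hk hP)
    have hinv : Tendsto (fun N : ℕ => ((N : ℂ)⁻¹) ^ (c + 1)) atTop (𝓝 0) := by
      simpa using (tendsto_inv_atTop_nhds_zero_nat (𝕜 := ℂ)).pow (c + 1)
    have hprod := tendsto_finsetProd P.parts fun V hV =>
      hκ V.card (P.nonempty_of_mem_parts hV).card_ne_zero
    have h := hprod.mul hinv
    rw [mul_zero] at h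
    refine h.congr' ?_
    filter_upwards [eventually_ne_atTop 0] with N hN
    have hN : (N : ℂ) ≠ 0 := Nat.cast_ne_zero.2 hN
    rw [Finset.prod_mul_distrib, Finset.prod_const, hc, add_comm 2 c, pow_succ _ (c + 1), inv_pow]
    field_simp
  have h := (hκ k hk).add (tendsto_finsetSum (properNC k) hproper)
  rw [Finset.sum_const_zero, add_zero] at h
  refine h.congr fun N => ?_
  rw [← Finset.mul_sum, ← mul_add, freeCumulantOf_eq_map_pow_sub, sub_add_cancel]

lemma twoStateCumulantOf_one (φ ψ : A →ₗ[ℂ] ℂ) (x : A) : twoStateCumulantOf φ ψ 1 x = φ x := by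
  have hproper : properNC 1 = ∅ := by
    refine Finset.eq_empty_of_forall_notMem fun P hP => ?_
    obtain ⟨V, hV, -⟩ := P.exists_mem (Finset.mem_univ 0)
    exact (Nat.lt_one_iff.1 (card_lt_of_mem_properNC hP hV)).not_gt
      (P.nonempty_of_mem_parts hV).card_pos
  rw [twoStateCumulantOf, twoStateCumulant, hproper, Finset.sum_empty, sub_zero, moment_const,
    pow_one]

lemma twoStateCumulantOf_two (hx : φ x = 0) : twoStateCumulantOf φ ψ 2 x = φ (x ^ 2) := by
  rw [twoStateCumulantOf, twoStateCumulant, moment_const, sub_eq_self]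
  refine Finset.sum_eq_zero fun P hP => ?_
  obtain ⟨V, hV, -⟩ := P.exists_mem (Finset.mem_univ 0)
  have card_block (U : Finset (Fin 2)) (hU : U ∈ P.parts) : U.card = 1 :=
    le_antisymm (Nat.lt_succ_iff.1 (card_lt_of_mem_properNC hP hU))
      (P.nonempty_of_mem_parts hU).card_pos
  have not_inner : ¬ IsInner P V := by
    rintro ⟨U, hU, y₁, hy₁, y₂, hy₂, hV_between⟩
    obtain ⟨z, hz⟩ := P.nonempty_of_mem_parts hV
    obtain ⟨hyz, hzy⟩ := hV_between z hz
    exact (hyz.trans hzy).ne (Finset.card_le_one.1 (card_block U hU).le y₁ hy₁ y₂ hy₂)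
  refine Finset.prod_eq_zero hV ?_
  rw [if_neg not_inner, dif_pos (card_lt_of_mem_properNC hP hV)]
  change twoStateCumulantOf φ ψ V.card x = 0
  rw [card_block V hV, twoStateCumulantOf_one, hx]

end FreeCumulants

section Freeness

variable {R A ι : Type*} [CommRing R] [Ring A] [Algebra R A]

/-- The word `l`, whose letters are labelled by the algebras they come from, is an alternating word
in `ψ`-centered elements of the algebras `B i`. -/
def IsAlternating (ψ : A →ₗ[R] R) (B : ι → Subalgebra R A) (l : List (ι × A)) : Prop :=
  l.IsChain (·.1 ≠ ·.1) ∧ ∀ p ∈ l, p.2 ∈ B p.1 ∧ ψ p.2 = 0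

/-- Free independence of the subalgebras `B i` with respect to `ψ`. -/
def IsFree (ψ : A →ₗ[R] R) (B : ι → Subalgebra R A) : Prop :=
  ∀ l ≠ [], IsAlternating ψ B l → ψ (l.map Prod.snd).prod = 0

/-- The span of the alternating products of `ψ`-centered elements whose first factor is in
`B i`. -/
def alternatingSpan (ψ : A →ₗ[R] R) (B : ι → Subalgebra R A) (i : ι) : Submodule R A :=
  Submodule.span R
    {z | ∃ a l, IsAlternating ψ B ((i, a) :: l) ∧ (((i, a) :: l).map Prod.snd).prod = z}

variable {ψ : A →ₗ[R] R} {B : ι → Subalgebra R A} {i j : ι}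

lemma mem_alternatingSpan {a : A} (ha : a ∈ B i) (hψa : ψ a = 0) : a ∈ alternatingSpan ψ B i :=
  Submodule.subset_span ⟨a, [], by simp [IsAlternating, ha, hψa], by simp⟩

lemma mul_mem_alternatingSpan (hij : i ≠ j) {a z : A} (ha : a ∈ B i) (hψa : ψ a = 0)
    (hz : z ∈ alternatingSpan ψ B j) : a * z ∈ alternatingSpan ψ B i := by
  suffices h : alternatingSpan ψ B j ≤
      (alternatingSpan ψ B i).comap (LinearMap.mulLeft R a) from h hz
  refine Submodule.span_le.2 ?_
  rintro _ ⟨b, l, ⟨hchain, hl⟩, rfl⟩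
  refine Submodule.subset_span ⟨a, (j, b) :: l, ⟨?_, ?_⟩, rfl⟩
  · exact List.isChain_cons_cons.2 ⟨hij, hchain⟩
  · exact List.forall_mem_cons.2 ⟨⟨ha, hψa⟩, hl⟩

lemma IsFree.map_eq_zero (hB : IsFree ψ B) {z : A} (hz : z ∈ alternatingSpan ψ B i) :
    ψ z = 0 := by
  suffices h : alternatingSpan ψ B i ≤ LinearMap.ker ψ from h hz
  refine Submodule.span_le.2 ?_
  rintro _ ⟨a, l, hl, rfl⟩
  exact hB _ (List.cons_ne_nil _ _) hl

lemma coeff_mem_alternatingSpan_of_forall_lt (hij : i ≠ j) {P F G : PowerSeries A}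
    (hP₀ : PowerSeries.constantCoeff P = 0)
    (hP : ∀ n, PowerSeries.coeff n P ∈ B i ∧ ψ (PowerSeries.coeff n P) = 0)
    (hF : F = P + P * G) {n : ℕ}
    (hG : ∀ k < n, PowerSeries.coeff k G ∈ alternatingSpan ψ B j) :
    PowerSeries.coeff n F ∈ alternatingSpan ψ B i := by
  rw [hF, map_add, PowerSeries.coeff_mul]
  refine add_mem (mem_alternatingSpan (hP n).1 (hP n).2) (sum_mem fun p hp => ?_)
  have hsum := Finset.HasAntidiagonal.mem_antidiagonal.1 hp
  rcases eq_or_ne p.1 0 with h₀ | h₀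
  · simp [h₀, hP₀]
  · exact mul_mem_alternatingSpan hij (hP p.1).1 (hP p.1).2 (hG p.2 (by lia))

lemma coeff_mem_alternatingSpan (hij : i ≠ j) {P Q F G : PowerSeries A}
    (hP₀ : PowerSeries.constantCoeff P = 0) (hQ₀ : PowerSeries.constantCoeff Q = 0)
    (hP : ∀ n, PowerSeries.coeff n P ∈ B i ∧ ψ (PowerSeries.coeff n P) = 0)
    (hQ : ∀ n, PowerSeries.coeff n Q ∈ B j ∧ ψ (PowerSeries.coeff n Q) = 0)
    (hF : F = P + P * G) (hG : G = Q + Q * F) (n : ℕ) :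
    PowerSeries.coeff n F ∈ alternatingSpan ψ B i ∧
      PowerSeries.coeff n G ∈ alternatingSpan ψ B j := by
  induction n using Nat.strong_induction_on with
  | _ n ih =>
    exact ⟨coeff_mem_alternatingSpan_of_forall_lt hij hP₀ hP hF fun k hk => (ih k hk).2,
      coeff_mem_alternatingSpan_of_forall_lt hij.symm hQ₀ hQ hG fun k hk => (ih k hk).1⟩

lemma coeff_wickSeries_sub_one {r : ℕ → R} {x : A} (hx : x ∈ B i)
    (hψx : ∀ n ≠ 0, ψ (wick r x n) = 0) (n : ℕ) :
    PowerSeries.coeff n (wickSeries r x - 1) ∈ B i ∧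
      ψ (PowerSeries.coeff n (wickSeries r x - 1)) = 0 := by
  rw [map_sub, PowerSeries.coeff_one, ← wick]
  rcases eq_or_ne n 0 with rfl | hn
  · simp [wick_zero]
  · simpa [hn] using ⟨wick_mem r hx n, hψx n hn⟩

/-- The Wick polynomials of `x + y` are alternating sums of products of those of `x` and `y`:
with `P`, `Q`, `U` the three generating functions, `P⁻¹ + Q⁻¹ = 1 + U⁻¹` gives
`U - 1 = F + G` where `F = Q⁻¹ U - 1` and `G = P⁻¹ U - 1` satisfy `F = (P - 1)(1 + G)` and
`G = (Q - 1)(1 + F)`. -/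
lemma IsFree.map_wick_add (hB : IsFree ψ B) (hij : i ≠ j) {r s : ℕ → R} {x y : A}
    (hx : x ∈ B i) (hy : y ∈ B j) (hψx : ∀ n ≠ 0, ψ (wick r x n) = 0)
    (hψy : ∀ n ≠ 0, ψ (wick s y n) = 0) {n : ℕ} (hn : n ≠ 0) :
    ψ (wick (r + s) (x + y) n) = 0 := by
  set P := wickSeries r x
  set Q := wickSeries s y
  set U := wickSeries (r + s) (x + y)
  set F := wickInv s y * U - 1
  set G := wickInv r x * U - 1
  have hPG : P + P * G = U := by
    rw [mul_sub, ← mul_assoc, wickSeries_mul_wickInv, one_mul, mul_one, add_sub_cancel]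
  have hQF : Q + Q * F = U := by
    rw [mul_sub, ← mul_assoc, wickSeries_mul_wickInv, one_mul, mul_one, add_sub_cancel]
  have hU : U = 1 + F + G := by
    have h := wickInv_mul_wickSeries (r + s) (x + y)
    rw [wickInv_add, sub_mul, add_mul, one_mul, sub_eq_iff_eq_add'] at h
    rw [add_assoc, sub_add_sub_comm, add_comm (wickInv s y * U), h]
    abel
  have hF : F = (P - 1) + (P - 1) * G := by
    rw [sub_mul, one_mul, sub_add_sub_comm, hPG, hU]
    abel
  have hG : G = (Q - 1) + (Q - 1) * F := by
    rw [sub_mul, one_mul, sub_add_sub_comm, hQF, hU]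
    abel
  obtain ⟨hF_mem, hG_mem⟩ := coeff_mem_alternatingSpan hij (by simp [wickSeries])
    (by simp [wickSeries]) (coeff_wickSeries_sub_one hx hψx) (coeff_wickSeries_sub_one hy hψy)
    hF hG n
  have hwick : wick (r + s) (x + y) n = PowerSeries.coeff n F + PowerSeries.coeff n G := by
    change PowerSeries.coeff n U = _
    rw [hU, map_add, map_add, PowerSeries.coeff_one, if_neg hn, zero_add]
  rw [hwick, map_add, hB.map_eq_zero hF_mem, hB.map_eq_zero hG_mem, add_zero]

end Freeness

section FreeIncrements

variable {A ι : Type*} [Ring A] [Algebra ℂ A] {φ ψ : A →ₗ[ℂ] ℂ} {B : ι → Subalgebra ℂ A}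

lemma IsTwoStateFree.isFree [StarRing A] (hB : IsTwoStateFree φ ψ B) : IsFree ψ B := by
  refine List.forall_iff_forall_tuple.2 fun n w hw ⟨hchain, hw_mem⟩ => ?_
  cases n with
  | zero => simp at hw
  | succ n =>
    rw [List.map_ofFn]
    rw [List.forall_mem_ofFn_iff] at hw_mem
    exact (hB n (fun k => (w k).1) (fun k => (w k).2) (fun k => (hw_mem k).1)
      (fun k => List.isChain_ofFn.1 hchain k (by lia)) fun k => (hw_mem k).2).1

theorem IsFree.freeCumulantOf_add (hB : IsFree ψ B) (hψ : ψ 1 = 1) {i j : ι} (hij : i ≠ j)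
    {x y : A} (hx : x ∈ B i) (hy : y ∈ B j) {n : ℕ} (hn : n ≠ 0) :
    freeCumulantOf ψ n (x + y) = freeCumulantOf ψ n x + freeCumulantOf ψ n y := by
  have map_wick (z : A) : ∀ n ≠ 0, ψ (wick (freeCumulantOf ψ · z) z n) = 0 :=
    (map_wick_eq_zero_iff hψ _ z).2 fun _ _ => rfl
  exact (map_wick_eq_zero_iff hψ ((freeCumulantOf ψ · x) + (freeCumulantOf ψ · y)) (x + y)).1
    (fun n hn => hB.map_wick_add hij hx hy (map_wick x) (map_wick y) hn) n hn

end FreeIncrements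

section AdditiveFunctions

/-- `f` is additive on the interval `[0, T]`; its values elsewhere are irrelevant. -/
def IsAdditiveUpTo {M : Type*} [Add M] (T : ℝ) (f : ℝ → M) : Prop :=
  ∀ s t, 0 ≤ s → 0 ≤ t → s + t ≤ T → f (s + t) = f s + f t

namespace IsAdditiveUpTo

variable {T : ℝ}

section AddCommGroup

variable {M : Type*} [AddCommGroup M] {f : ℝ → M}

lemma map_zero (hf : IsAdditiveUpTo T f) (hT : 0 ≤ T) : f 0 = 0 := by
  simpa using hf 0 0 le_rfl le_rfl (by simpa using hT)

lemma map_natCast_mul (hf : IsAdditiveUpTo T f) {u : ℝ} (hu : 0 ≤ u) {j : ℕ} (hj : j * u ≤ T) :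
    f (j * u) = j • f u := by
  induction j with
  | zero => simpa using hf.map_zero (by simpa using hj)
  | succ j ih =>
    rw [Nat.cast_succ, add_mul, one_mul] at hj ⊢
    rw [hf _ _ (by positivity) hu hj, ih (by linarith), succ_nsmul]

lemma nsmul_map_div (hf : IsAdditiveUpTo T f) (hT : 0 ≤ T) {N : ℕ} (hN : N ≠ 0) :
    N • f (T / N) = f T := by
  have hNT : N * (T / N) = T := mul_div_cancel₀ T (Nat.cast_ne_zero.2 hN)
  rw [← hf.map_natCast_mul (by positivity) hNT.le, hNT]

end AddCommGroup

section Real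

variable {f : ℝ → ℝ}

lemma monotoneOn (hf : IsAdditiveUpTo T f) (hf₀ : ∀ t ∈ Set.Icc 0 T, 0 ≤ f t) :
    MonotoneOn f (Set.Icc 0 T) := by
  intro s hs t ht hst
  have h := hf s (t - s) hs.1 (sub_nonneg.2 hst) (by simpa using ht.2)
  rw [add_sub_cancel] at h
  rw [h]
  exact le_add_of_nonneg_right (hf₀ _ ⟨sub_nonneg.2 hst, (sub_le_self t hs.1).trans ht.2⟩)

lemma mul_map_div_sub_le (hf : IsAdditiveUpTo T f) (hf₀ : ∀ t ∈ Set.Icc 0 T, 0 ≤ f t)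
    (hT : 0 < T) {t : ℝ} (ht : t ∈ Set.Icc 0 T) {N : ℕ} (hN : N ≠ 0) :
    f T / T * t - f T / N ≤ f t := by
  have hN₀ : (0 : ℝ) < N := Nat.cast_pos.2 (Nat.pos_of_ne_zero hN)
  have hu : 0 < T / N := by positivity
  set j := ⌊t / (T / N)⌋₊
  have hjt : j * (T / N) ≤ t := (le_div_iff₀ hu).1 (Nat.floor_le (div_nonneg ht.1 hu.le))
  have htj : t / (T / N) ≤ j + 1 := (Nat.lt_floor_add_one _).le
  have hfT : 0 ≤ f T := hf₀ T ⟨hT.le, le_rfl⟩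
  have hfu : f (T / N) = f T / N := by
    rw [eq_div_iff hN₀.ne', mul_comm, ← nsmul_eq_mul, hf.nsmul_map_div hT.le hN]
  calc f T / T * t - f T / N = (t / (T / N) - 1) * (f T / N) := by field_simp
    _ ≤ j * (f T / N) := by gcongr; linarith
    _ = f (j * (T / N)) := by rw [hf.map_natCast_mul hu.le (hjt.trans ht.2), nsmul_eq_mul, hfu]
    _ ≤ f t := hf.monotoneOn hf₀ ⟨by positivity, hjt.trans ht.2⟩ ht hjt

lemma div_mul_le (hf : IsAdditiveUpTo T f) (hf₀ : ∀ t ∈ Set.Icc 0 T, 0 ≤ f t) (hT : 0 < T)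
    {t : ℝ} (ht : t ∈ Set.Icc 0 T) : f T / T * t ≤ f t := by
  have hlim : Tendsto (fun N : ℕ => f T / T * t - f T / N) atTop (𝓝 (f T / T * t)) := by
    simpa using (tendsto_const_div_atTop_nhds_zero_nat (f T)).const_sub (f T / T * t)
  exact le_of_tendsto hlim
    ((eventually_ne_atTop 0).mono fun N hN => hf.mul_map_div_sub_le hf₀ hT ht hN)

theorem eq_div_mul (hf : IsAdditiveUpTo T f) (hf₀ : ∀ t ∈ Set.Icc 0 T, 0 ≤ f t) (hT : 0 < T)
    {t : ℝ} (ht : t ∈ Set.Icc 0 T) : f t = f T / T * t := by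
  refine le_antisymm ?_ (hf.div_mul_le hf₀ hT ht)
  have hsplit := hf t (T - t) ht.1 (sub_nonneg.2 ht.2) (add_sub_cancel t T).le
  have hle := hf.div_mul_le hf₀ hT (t := T - t) ⟨sub_nonneg.2 ht.2, sub_le_self T ht.1⟩
  rw [add_sub_cancel] at hsplit
  rw [mul_sub, div_mul_cancel₀ _ hT.ne'] at hle
  linarith

end Real

end IsAdditiveUpTo

end AdditiveFunctions

section Increments

variable {A : Type*} [Ring A] [StarRing A] [Algebra ℂ A]
variable {φ ψ : A →ₗ[ℂ] ℂ} {T : ℝ} {X : ℝ → A}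

namespace HasTwoStateFreeIncrements

lemma map_sub_pow (hX : HasTwoStateFreeIncrements φ ψ T X) {s t : ℝ} (hs : 0 ≤ s) (ht : 0 ≤ t)
    (hst : s + t ≤ T) (k : ℕ) : ψ ((X (s + t) - X s) ^ k) = ψ (X t ^ k) := by
  have h := (hX.stationary 0 t s le_rfl ht hs (by linarith) k).2
  rwa [zero_add, hX.zero, sub_zero, add_comm t s] at h

theorem isAdditiveUpTo_freeCumulantOf (hX : HasTwoStateFreeIncrements φ ψ T X) (hψ : ψ 1 = 1)
    {n : ℕ} (hn : n ≠ 0) : IsAdditiveUpTo T fun t => freeCumulantOf ψ n (X t) := by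
  intro s t hs ht hst
  have hle (i : Fin 2) : 0 ≤ ![0, s] i ∧ ![0, s] i ≤ ![s, s + t] i ∧ ![s, s + t] i ≤ T := by
    fin_cases i
    · exact ⟨le_rfl, hs, show s ≤ T by linarith⟩
    · exact ⟨hs, show s ≤ s + t by linarith, hst⟩
  have hdisj (i j : Fin 2) (hij : i ≠ j) : Disjoint (Set.Ico (![0, s] i) (![s, s + t] i))
      (Set.Ico (![0, s] j) (![s, s + t] j)) := by
    have h : Disjoint (Set.Ico 0 s) (Set.Ico s (s + t)) := Set.Ico_disjoint_Ico_same
    fin_cases i <;> fin_cases j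
    exacts [absurd rfl hij, h, h.symm, absurd rfl hij]
  have hfree := (hX.free 2 ![0, s] ![s, s + t] hle hdisj).isFree
  have hadd := hfree.freeCumulantOf_add hψ zero_ne_one
    (Algebra.self_mem_adjoin_singleton ℂ (X s - X 0))
    (Algebra.self_mem_adjoin_singleton ℂ (X (s + t) - X s)) hn
  have hstat := freeCumulantOf_congr (hX.map_sub_pow hs ht hst) n
  simpa only [hX.zero, sub_zero, add_sub_cancel, hstat] using hadd

lemma map_variationSum (hX : HasTwoStateFreeIncrements φ ψ T X) (hT : 0 ≤ T) (k : ℕ) {N : ℕ}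
    (hN : N ≠ 0) : ψ (variationSum T X k N) = N * ψ (X (T / N) ^ k) := by
  have hN₀ : (0 : ℝ) < N := Nat.cast_pos.2 (Nat.pos_of_ne_zero hN)
  have hincr (i : ℕ) (hi : i ∈ Finset.range N) :
      ψ ((X (((i : ℝ) + 1) / N * T) - X ((i : ℝ) / N * T)) ^ k) = ψ (X (T / N) ^ k) := by
    have hiN : (i : ℝ) + 1 ≤ N := by exact_mod_cast Finset.mem_range.1 hi
    have hsplit : ((i : ℝ) + 1) / N * T = i / N * T + T / N := by ring
    rw [hsplit, hX.map_sub_pow (by positivity) (by positivity)]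
    rw [← hsplit]
    exact mul_le_of_le_one_left hT ((div_le_one hN₀).2 hiN)
  rw [variationSum, map_sum, Finset.sum_congr rfl hincr, Finset.sum_const, Finset.card_range,
    nsmul_eq_mul]

theorem tendsto_map_variationSum (hX : HasTwoStateFreeIncrements φ ψ T X) (hψ : ψ 1 = 1)
    (hT : 0 ≤ T) {k : ℕ} (hk : k ≠ 0) :
    Tendsto (fun N : ℕ => ψ (variationSum T X k N)) atTop (𝓝 (freeCumulantOf ψ k (X T))) := by
  have hκ (j : ℕ) (hj : j ≠ 0) : Tendsto (fun N : ℕ => N * freeCumulantOf ψ j (X (T / N)))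
      atTop (𝓝 (freeCumulantOf ψ j (X T))) := by
    refine tendsto_const_nhds.congr' ?_
    filter_upwards [eventually_ne_atTop 0] with N hN
    rw [← nsmul_eq_mul, (hX.isAdditiveUpTo_freeCumulantOf hψ hj).nsmul_map_div hT hN]
  refine (tendsto_natCast_mul_map_pow hκ hk).congr' ?_
  filter_upwards [eventually_ne_atTop 0] with N hN
  rw [hX.map_variationSum hT k hN]

theorem freeCumulantOf_eq_div_mul (hX : HasTwoStateFreeIncrements φ ψ T X) (hψ : ψ 1 = 1)
    (hT : 0 < T) {n : ℕ} (hn : n ≠ 0)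
    (hcum : ∀ t ∈ Set.Icc 0 T, 0 ≤ freeCumulantOf ψ n (X t)) {t : ℝ} (ht : t ∈ Set.Icc 0 T) :
    freeCumulantOf ψ n (X t) = (((freeCumulantOf ψ n (X T)).re / T * t : ℝ) : ℂ) := by
  have hadd : IsAdditiveUpTo T fun t => (freeCumulantOf ψ n (X t)).re := fun s t hs ht hst =>
    (congrArg Complex.re (hX.isAdditiveUpTo_freeCumulantOf hψ hn s t hs ht hst)).trans
      (Complex.add_re _ _)
  rw [← hadd.eq_div_mul (fun t ht => (Complex.nonneg_iff.1 (hcum t ht)).1) hT ht]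
  exact Complex.eq_re_of_ofReal_le (hcum t ht)

end HasTwoStateFreeIncrements

end Increments

lemma IsState.continuous {A : Type*} [CStarAlgebra A] {ψ : A →ₗ[ℂ] ℂ} (hψ : IsState ψ) :
    Continuous ψ := by
  let _ := CStarAlgebra.spectralOrder A
  have := CStarAlgebra.spectralOrderedRing A
  let f : A →ₚ[ℂ] ℂ := PositiveLinearMap.mk₀ ψ fun x hx => by
    obtain ⟨y, rfl⟩ := CStarAlgebra.nonneg_iff_eq_star_mul_self.1 hx
    exact hψ.nonneg y
  exact map_continuous f

end TwoStateFree

end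

open TwoStateFree in
theorem mainTheorem12_general {A : Type*} [Ring A] [StarRing A] [Algebra ℂ A] {φ ψ : A →ₗ[ℂ] ℂ}
    (hψ : ψ 1 = 1) {T : ℝ} (hT : 0 < T) {X : ℝ → A} (hX : IsAlgebraicTwoStateFreeBM φ ψ T X)
    (hcum : ∀ t ∈ Set.Icc 0 T, ∀ n : ℕ, 1 ≤ n → 0 ≤ freeCumulantOf ψ n (X t))
    (hvar : ∀ k : ℕ, 2 < k → Tendsto (fun N : ℕ => ψ (variationSum T X k N)) atTop (𝓝 0))
    (hquad : Tendsto (fun N : ℕ => ψ (variationSum T X 2 N)) atTop (𝓝 (T : ℂ))) :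
    ∃ α : ℝ, IsTwoStateFreeBM φ ψ T X α := by
  have linear (k : ℕ) (hk : k ≠ 0) (t : ℝ) (ht : t ∈ Set.Icc 0 T) :
      freeCumulantOf ψ k (X t) = (((freeCumulantOf ψ k (X T)).re / T * t : ℝ) : ℂ) :=
    hX.freeCumulantOf_eq_div_mul hψ hT hk
      (fun s hs => hcum s hs k (Nat.one_le_iff_ne_zero.2 hk)) ht
  have cumulant_two : freeCumulantOf ψ 2 (X T) = T :=
    tendsto_nhds_unique (hX.tendsto_map_variationSum hψ hT.le two_ne_zero) hquad
  have cumulant_higher (k : ℕ) (hk : 2 < k) : freeCumulantOf ψ k (X T) = 0 :=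
    tendsto_nhds_unique (hX.tendsto_map_variationSum hψ hT.le (by lia)) (hvar k hk)
  refine ⟨(freeCumulantOf ψ 1 (X T)).re / T, hX, linear 1 one_ne_zero,
    fun t ht => ⟨?_, ?_⟩, fun k hk t ht => ?_⟩
  · rw [linear 2 two_ne_zero t ht, cumulant_two, Complex.ofReal_re, div_self hT.ne', one_mul]
  · rw [twoStateCumulantOf_two (hX.mean_zero t ht)]
    simpa [hX.zero] using hX.variance 0 t le_rfl ht.1 ht.2
  · rw [linear k (by lia) t ht, cumulant_higher k hk, Complex.zero_re, zero_div, zero_mul,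
      Complex.ofReal_zero]

theorem mainTheorem12 {A : Type*} [CStarAlgebra A] (φ ψ : A →ₗ[ℂ] ℂ)
    (hφ : TwoStateFree.IsState φ) (hψ : TwoStateFree.IsState ψ)
    (hφ_faithful : TwoStateFree.IsFaithful φ)
    (T : ℝ) (hT : 0 < T) (X : ℝ → A)
    (hX : TwoStateFree.IsAlgebraicTwoStateFreeBM φ ψ T X)
    (hgen : (StarAlgebra.adjoin ℂ (X '' Set.Icc 0 T)).topologicalClosure = ⊤)
    (hcum : ∀ t ∈ Set.Icc 0 T, ∀ n : ℕ, 1 ≤ n → 0 ≤ TwoStateFree.freeCumulantOf ψ n (X t))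
    (hvar : ∀ k : ℕ, 2 < k →
      Tendsto (fun N : ℕ => TwoStateFree.variationSum T X k N) atTop (𝓝 0))
    (hquad : Tendsto (fun N : ℕ => TwoStateFree.variationSum T X 2 N) atTop
      (𝓝 (algebraMap ℂ A (T : ℂ)))) :
    ∃ α : ℝ, TwoStateFree.IsTwoStateFreeBM φ ψ T X α :=
  mainTheorem12_general hψ.map_one hT hX hcum
    (fun k hk => by
      simpa [Function.comp_def] using (hψ.continuous.tendsto 0).comp (hvar k hk))
    (by simpa [Function.comp_def, Algebra.algebraMap_eq_smul_one, hψ.map_one] using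
      (hψ.continuous.tendsto _).comp hquad)
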